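/- Let $d\in\mathbb N_0$ and let $(M_p)_{p\in\mathbb N_0}$ be a sequence of positive real numbers such that $(M2)'$: there are $A,H>0$ with $M_{p+1}\le A H^{p}M_p$ for all $p\in\mathbb N_0$; and such that there is $H>0$ such that for every $C>0$ there is $B>0$ with $$s^{s/2}M_p\le B\,C^{s}H^{s+p}M_{s+p}\qquad\text{for all } s,p\in\mathbb N_0$$ (where $0^0=1$). Then the space $$\mathcal S_{(M_p)}(\mathbb R^d)=\Big\{f\in C^\infty(\mathbb R^d):\ \|f\|_j:=\sup_{\alpha,\beta\in\mathbb N_0^d}\ \sup_{x\in\mathbb R^d}\frac{|x^\alpha D^\beta f(x)|\,j^{|\alpha+\beta|}}{M_{|\alpha+\beta|}}<\infty\ \text{ for all } j\in\mathbb N=\{1,2,\dots\}\Big\}$$ of complex-valued functions, with the locally convex topology given by the seminorms $\|\cdot\|_j$, $j\in\mathbb N$, is nuclear. That is, it is a Hausdorff locally convex space $E$ and for every continuous seminorm $p$ on $E$ there is a continuous seminorm $q\ge p$ such that the canonical map $\widehat E_q\to\widehat E_p$ between the completions of $E/\ker q$ and $E/\ker p$ (normed by $q$ and $p$) is a nuclear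 operator, where a continuous linear map $T:X\to Y$ of Banach spaces is nuclear if $Tx=\sum_{n}f_n(x)\,y_n$ for all $x\in X$, for some $f_n\in X'$, $y_n\in Y$ with $\sum_n\|f_n\|\,\|y_n\|<\infty$. -/

import Mathlib

open scoped ContDiff

noncomputable section

/-! ### Nuclear operators and nuclear spaces -/

/-- A continuous linear map `T : X → Y` between Banach spaces is nuclear if it can be written as
`T x = ∑ₙ fₙ(x) yₙ` with `fₙ ∈ X'`, `yₙ ∈ Y` and `∑ₙ ‖fₙ‖ ‖yₙ‖ < ∞`. -/
def IsNuclearOperator {X Y : Type*} [NormedAddCommGroup X] [NormedSpace ℂ X]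
    [NormedAddCommGroup Y] [NormedSpace ℂ Y] (T : X →L[ℂ] Y) : Prop :=
  ∃ (f : ℕ → X →L[ℂ] ℂ) (y : ℕ → Y),
    Summable (fun n => ‖f n‖ * ‖y n‖) ∧ ∀ x : X, HasSum (fun n => f n x • y n) (T x)

/-- The vector space `E` endowed with the (semi)norm `p`. -/
def SeminormCopy {E : Type*} [AddCommGroup E] [Module ℂ E] (_p : Seminorm ℂ E) : Type _ := E

section SeminormCopy

variable {E : Type*} [AddCommGroup E] [Module ℂ E]

instance (p : Seminorm ℂ E) : SeminormedAddCommGroup (SeminormCopy p) :=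
  p.toAddGroupSeminorm.toSeminormedAddCommGroup

instance (p : Seminorm ℂ E) : Module ℂ (SeminormCopy p) :=
  inferInstanceAs (Module ℂ E)

instance (p : Seminorm ℂ E) : NormedSpace ℂ (SeminormCopy p) where
  norm_smul_le c x := (map_smul_eq_mul p c x).le

/-- The local Banach space of the seminorm `p`: the Hausdorff completion of `(E, p)`, i.e. the
completion of the normed space `E / ker p`. -/
abbrev LocalBanachSpace (p : Seminorm ℂ E) : Type _ :=
  UniformSpace.Completion (SeminormCopy p)

/-- For `p ≤ q`, the identity of `E` as a continuous linear map `(E, q) → (E, p)`. -/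
def seminormCopyMap {p q : Seminorm ℂ E} (h : p ≤ q) : SeminormCopy q →L[ℂ] SeminormCopy p :=
  LinearMap.mkContinuous
    ({ toFun := fun x => x
       map_add' := fun _ _ => rfl
       map_smul' := fun _ _ => rfl } : SeminormCopy q →ₗ[ℂ] SeminormCopy p) 1
    (fun x => by
      change p x ≤ 1 * q x
      exact (h x).trans (one_mul (q x)).ge)

/-- For `p ≤ q`, the canonical linking map between the local Banach spaces, i.e. the continuous
extension of the identity `(E, q) → (E, p)` to the completions. -/
def linkingMap {p q : Seminorm ℂ E} (h : p ≤ q) :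
    LocalBanachSpace q →L[ℂ] LocalBanachSpace p :=
  (seminormCopyMap h).completion

end SeminormCopy

/-- A complex vector space with a topology is a nuclear space if it is a Hausdorff locally convex
space (its topology is the vector space topology given by its continuous seminorms) and for every
continuous seminorm `p` there is a continuous seminorm `q ≥ p` such that the canonical linking map
from the local Banach space of `q` to that of `p` is nuclear. -/
structure IsNuclearSpace (E : Type*) [AddCommGroup E] [Module ℂ E] [TopologicalSpace E] :
    Prop where
  t2 : T2Space E
  locallyConvex : PolynormableSpace ℂ E
  linking_nuclear : ∀ p : Seminorm ℂ E, Continuous p →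
    ∃ (q : Seminorm ℂ E) (h : p ≤ q), Continuous q ∧ IsNuclearOperator (linkingMap h)

/-! ### The space `S_(M_p)(ℝ^d)` -/

/-- The `i`-th partial derivative of a (differentiable) function on `ℝ^d`. -/
def partialD {d : ℕ} (i : Fin d) (f : EuclideanSpace ℝ (Fin d) → ℂ) :
    EuclideanSpace ℝ (Fin d) → ℂ :=
  fun x => fderiv ℝ f x (EuclideanSpace.single i 1)

/-- The iterated partial derivative `D^β f = ∂₁^{β₁} ⋯ ∂_d^{β_d} f` of a smooth function. -/
def multiD {d : ℕ} (β : Fin d → ℕ) (f : EuclideanSpace ℝ (Fin d) → ℂ) :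
    EuclideanSpace ℝ (Fin d) → ℂ :=
  (List.finRange d).foldr (fun i g => (partialD i)^[β i] g) f

section Linearity

variable {d : ℕ} {f g : EuclideanSpace ℝ (Fin d) → ℂ}

theorem partialD_contDiff (hf : ContDiff ℝ ∞ f) (i : Fin d) : ContDiff ℝ ∞ (partialD i f) :=
  (hf.fderiv_right (m := ∞) (by simp)).clm_apply contDiff_const

theorem partialD_add (hf : ContDiff ℝ ∞ f) (hg : ContDiff ℝ ∞ g) (i : Fin d) :
    partialD i (f + g) = partialD i f + partialD i g := by
  funext x
  simp [partialD, fderiv_add (hf.differentiable (by simp) x) (hg.differentiable (by simp) x)]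

theorem partialD_smul (hf : ContDiff ℝ ∞ f) (c : ℂ) (i : Fin d) :
    partialD i (c • f) = c • partialD i f := by
  funext x
  simp [partialD, fderiv_const_smul (hf.differentiable (by simp) x) c]

theorem iterate_partialD (i : Fin d) (n : ℕ) (c : ℂ) (hf : ContDiff ℝ ∞ f)
    (hg : ContDiff ℝ ∞ g) :
    ContDiff ℝ ∞ ((partialD i)^[n] f) ∧
      (partialD i)^[n] (f + g) = (partialD i)^[n] f + (partialD i)^[n] g ∧
      (partialD i)^[n] (c • f) = c • (partialD i)^[n] f := by
  induction n generalizing f g with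
  | zero => exact ⟨hf, rfl, rfl⟩
  | succ n ih =>
    simp only [Function.iterate_succ, Function.comp_apply, partialD_add hf hg,
      partialD_smul hf]
    exact ih (partialD_contDiff hf i) (partialD_contDiff hg i)

theorem foldr_partialD (β : Fin d → ℕ) (c : ℂ) (hf : ContDiff ℝ ∞ f) (hg : ContDiff ℝ ∞ g)
    (l : List (Fin d)) :
    ContDiff ℝ ∞ (l.foldr (fun i g => (partialD i)^[β i] g) f) ∧
      l.foldr (fun i g => (partialD i)^[β i] g) (f + g) =
        l.foldr (fun i g => (partialD i)^[β i] g) f +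
          l.foldr (fun i g => (partialD i)^[β i] g) g ∧
      l.foldr (fun i g => (partialD i)^[β i] g) (c • f) =
        c • l.foldr (fun i g => (partialD i)^[β i] g) f := by
  induction l generalizing f g with
  | nil => exact ⟨hf, rfl, rfl⟩
  | cons i l ih =>
    have h1 := ih hf hg
    have h2 := ih hg hf
    have h3 := iterate_partialD i (β i) c h1.1 h2.1
    simp only [List.foldr_cons, h1.2.1, h1.2.2]
    exact h3

theorem multiD_add (β : Fin d → ℕ) (hf : ContDiff ℝ ∞ f) (hg : ContDiff ℝ ∞ g) :
    multiD β (f + g) = multiD β f + multiD β g :=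
  (foldr_partialD β 0 hf hg _).2.1

theorem multiD_smul (β : Fin d → ℕ) (c : ℂ) (hf : ContDiff ℝ ∞ f) :
    multiD β (c • f) = c • multiD β f :=
  (foldr_partialD β c hf hf _).2.2

end Linearity

/-- The quantity `|x^α D^β f(x)| j^{|α+β|} / M_{|α+β|}`, for `t = (α, β, x)`; for `M > 0` the
absolute value may be taken over the whole expression, as is done here. -/
def weightedTerm {d : ℕ} (M : ℕ → ℝ) (j : ℕ+) (f : EuclideanSpace ℝ (Fin d) → ℂ)
    (t : (Fin d → ℕ) × (Fin d → ℕ) × EuclideanSpace ℝ (Fin d)) : ℝ :=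
  ‖((∏ i, t.2.2 i ^ t.1 i) * ((j : ℕ) : ℝ) ^ (∑ i, (t.1 i + t.2.1 i)) /
      M (∑ i, (t.1 i + t.2.1 i))) • multiD t.2.1 f t.2.2‖

theorem weightedTerm_add_le {d : ℕ} (M : ℕ → ℝ) (j : ℕ+) {f g : EuclideanSpace ℝ (Fin d) → ℂ}
    (hf : ContDiff ℝ ∞ f) (hg : ContDiff ℝ ∞ g)
    (t : (Fin d → ℕ) × (Fin d → ℕ) × EuclideanSpace ℝ (Fin d)) :
    weightedTerm M j (f + g) t ≤ weightedTerm M j f t + weightedTerm M j g t := by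
  simp only [weightedTerm, multiD_add _ hf hg, Pi.add_apply, smul_add]
  exact norm_add_le _ _

theorem weightedTerm_smul {d : ℕ} (M : ℕ → ℝ) (j : ℕ+) (c : ℂ)
    {f : EuclideanSpace ℝ (Fin d) → ℂ} (hf : ContDiff ℝ ∞ f)
    (t : (Fin d → ℕ) × (Fin d → ℕ) × EuclideanSpace ℝ (Fin d)) :
    weightedTerm M j (c • f) t = ‖c‖ * weightedTerm M j f t := by
  simp only [weightedTerm, multiD_smul _ c hf, Pi.smul_apply]
  rw [smul_comm, norm_smul]

/-- The vector space of all `f ∈ C^∞(ℝ^d)` such that, for every `j ∈ {1, 2, …}`,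
`sup_{α, β, x} |x^α D^β f(x)| j^{|α+β|} / M_{|α+β|} < ∞`. -/
def ultraSubmodule (M : ℕ → ℝ) (d : ℕ) : Submodule ℂ (EuclideanSpace ℝ (Fin d) → ℂ) where
  carrier := {f | ContDiff ℝ ∞ f ∧ ∀ j : ℕ+, BddAbove (Set.range (weightedTerm M j f))}
  zero_mem' := by
    refine ⟨contDiff_const, fun j => ⟨0, ?_⟩⟩
    rintro _ ⟨t, rfl⟩
    have h := weightedTerm_smul M j 0 (f := (0 : EuclideanSpace ℝ (Fin d) → ℂ))
      contDiff_const t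
    simp only [zero_smul, norm_zero, zero_mul] at h
    exact h.le
  add_mem' := by
    rintro f g ⟨hf, hf'⟩ ⟨hg, hg'⟩
    refine ⟨hf.add hg, fun j => ?_⟩
    obtain ⟨a, ha⟩ := hf' j
    obtain ⟨b, hb⟩ := hg' j
    refine ⟨a + b, ?_⟩
    rintro _ ⟨t, rfl⟩
    exact (weightedTerm_add_le M j hf hg t).trans (add_le_add (ha ⟨t, rfl⟩) (hb ⟨t, rfl⟩))
  smul_mem' := by
    rintro c f ⟨hf, hf'⟩
    refine ⟨contDiff_const.smul hf, fun j => ?_⟩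
    obtain ⟨a, ha⟩ := hf' j
    refine ⟨‖c‖ * a, ?_⟩
    rintro _ ⟨t, rfl⟩
    rw [weightedTerm_smul M j c hf t]
    exact mul_le_mul_of_nonneg_left (ha ⟨t, rfl⟩) (norm_nonneg c)

/-- The space `S_(M_p)(ℝ^d)`. It is a separate type so that it does not carry the topology of
pointwise convergence. -/
def UltraSpace (M : ℕ → ℝ) (d : ℕ) : Type := ultraSubmodule M d

namespace UltraSpace

variable {M : ℕ → ℝ} {d : ℕ}

instance : AddCommGroup (UltraSpace M d) := inferInstanceAs (AddCommGroup (ultraSubmodule M d))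

instance : Module ℂ (UltraSpace M d) := inferInstanceAs (Module ℂ (ultraSubmodule M d))

/-- The function underlying an element of `S_(M_p)(ℝ^d)`. -/
def toFun (f : UltraSpace M d) : EuclideanSpace ℝ (Fin d) → ℂ := Subtype.val f

/-- The seminorm `f ↦ sup_{α, β, x} |x^α D^β f(x)| j^{|α+β|} / M_{|α+β|}`. -/
def seminorm (M : ℕ → ℝ) (d : ℕ) (j : ℕ+) : Seminorm ℂ (UltraSpace M d) :=
  Seminorm.of (fun f => ⨆ t, weightedTerm M j f.toFun t)
    (fun f g => ciSup_le fun t =>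
      (weightedTerm_add_le M j (Subtype.property f).1 (Subtype.property g).1 t).trans
        (add_le_add (le_ciSup ((Subtype.property f).2 j) t)
          (le_ciSup ((Subtype.property g).2 j) t)))
    (fun c f => by
      have h : ∀ t, weightedTerm M j (c • f).toFun t = ‖c‖ * weightedTerm M j f.toFun t :=
        fun t => weightedTerm_smul M j c (Subtype.property f).1 t
      simp only [h]
      exact (Real.mul_iSup_of_nonneg (norm_nonneg c) _).symm)

/-- The topology of `S_(M_p)(ℝ^d)` is the locally convex one given by its defining seminorms. -/
instance : TopologicalSpace (UltraSpace M d) :=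
  (SeminormFamily.moduleFilterBasis (𝕜 := ℂ) (seminorm M d)).topology

end UltraSpace

/-! ### The conditions on the sequence -/

/-- Komatsu's condition `(M2)'`, stability under differential operators:
there are `A, H > 0` with `M_{p+1} ≤ A H^p M_p` for all `p`. -/
def CondM2' (M : ℕ → ℝ) : Prop :=
  ∃ A > (0 : ℝ), ∃ H > (0 : ℝ), ∀ p : ℕ, M (p + 1) ≤ A * H ^ p * M p

/-- There is `H > 0` such that for any `C > 0` there is `B > 0` with
`s^{s/2} M_p ≤ B C^s H^{s+p} M_{s+p}` for all `s, p ∈ ℕ₀` (with `0^0 = 1`). -/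
def CondHermite (M : ℕ → ℝ) : Prop :=
  ∃ H > (0 : ℝ), ∀ C > (0 : ℝ), ∃ B > (0 : ℝ), ∀ s p : ℕ,
    (s : ℝ) ^ ((s : ℝ) / 2) * M p ≤ B * C ^ s * H ^ (s + p) * M (s + p)

end

/-! Nuclearity follows once every continuous seminorm `p` satisfies `p f ≤ ∫ |φ_t f| dμ(t)` for a
probability measure `μ` and linear functionals with `|φ_t| ≤ q`, where `q` is another continuous
seminorm (`AbsDominated`). The L²(μ) norm of `t ↦ φ_t f` is then a Hilbertian seminorm between `p`
and `q`, and the identity from `q` to it is absolutely 2-summing, as in Pietsch's theorem. Between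
Hilbert spaces such maps are Hilbert–Schmidt, and composing two of them gives a nuclear map
(`AbsDominated.isNuclearOperator_linkingMap`).

To dominate `seminorm M d j`, write `D^β f` as an iterated integral of `D^{β+1} f`, one variable at
a time; functions in the space vanish at infinity on coordinate lines, and the monomial moves inside
the integral because `|s| ≥ |x|` on the half-line used (`enorm_monomial_mul_multiD_le`). Cauchy
distributions replace Lebesgue measure, and geometric distributions turn the supremum over `α, β`
into an average. The price is a factor `2^N`, where `N = |α+β|`, and a shift of the order by at most
`3 * d`. By (M2)' the shift costs only a geometric factor, so a larger index `k` absorbs both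
(`exists_norm_weightedFunctional_le`). -/

open MeasureTheory Filter Topology
open scoped ENNReal

/-! ### Hilbertian seminorms and square summing pairs of seminorms -/

section Hilbertian

universe u

variable {E : Type u} [AddCommGroup E] [Module ℂ E]

/-- A seminorm is Hilbertian if it satisfies the parallelogram identity. -/
def IsHilbertianSeminorm (h : Seminorm ℂ E) : Prop :=
  ∀ f g : E, h (f + g) * h (f + g) + h (f - g) * h (f - g) = 2 * (h f * h f + h g * h g)

/-- The identity `(E, q) → (E, p)` is absolutely `2`-summing with constant `1`. -/
def SqSumming (p q : Seminorm ℂ E) : Prop :=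
  ∀ (ι : Type u) [Fintype ι] (f : ι → E) (K : ℝ), 0 ≤ K →
    (∀ c : ι → ℂ, q (∑ i, c i • f i) ^ 2 ≤ K * ∑ i, ‖c i‖ ^ 2) → ∑ i, p (f i) ^ 2 ≤ K

theorem SqSumming.mono {p p' q q' : Seminorm ℂ E} (h : SqSumming p q) (hp : p' ≤ p)
    (hq : q ≤ q') : SqSumming p' q' := fun ι _ f K hK hf =>
  (Finset.sum_le_sum fun i _ => pow_le_pow_left₀ (apply_nonneg _ _) (hp (f i)) 2).trans
    (h ι f K hK fun c => (pow_le_pow_left₀ (apply_nonneg _ _) (hq _) 2).trans (hf c))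

/-- The seminorm `p` is dominated by an average of linear functionals that are bounded by `q`. -/
def AbsDominated (p q : Seminorm ℂ E) : Prop :=
  ∃ (T : Type) (_ : MeasurableSpace T) (μ : Measure T) (_ : IsProbabilityMeasure μ)
    (φ : T → E →ₗ[ℂ] ℂ), (∀ f, Measurable fun t => φ t f) ∧ (∀ t f, ‖φ t f‖ ≤ q f) ∧
      ∀ f, ENNReal.ofReal (p f) ≤ ∫⁻ t, ‖φ t f‖ₑ ∂μ

/-- Testing the hypothesis with `c i = conj (φ (f i))` turns `φ (∑ c i • f i)` into the sum `s`
itself, so `s² ≤ K s`. -/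
theorem sum_norm_sq_apply_le {q : Seminorm ℂ E} (φ : E →ₗ[ℂ] ℂ) (hφ : ∀ f, ‖φ f‖ ≤ q f)
    {ι : Type*} [Fintype ι] (f : ι → E) {K : ℝ} (hK : 0 ≤ K)
    (hf : ∀ c : ι → ℂ, q (∑ i, c i • f i) ^ 2 ≤ K * ∑ i, ‖c i‖ ^ 2) :
    ∑ i, ‖φ (f i)‖ ^ 2 ≤ K := by
  set s := ∑ i, ‖φ (f i)‖ ^ 2 with hs
  have hs0 : 0 ≤ s := Finset.sum_nonneg fun i _ => by positivity
  have h1 := hf fun i => (starRingEnd ℂ) (φ (f i))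
  have h2 : φ (∑ i, (starRingEnd ℂ) (φ (f i)) • f i) = (s : ℂ) := by
    rw [map_sum, hs, Complex.ofReal_sum]
    refine Finset.sum_congr rfl fun i _ => ?_
    rw [map_smul, smul_eq_mul, Complex.conj_mul', Complex.ofReal_pow]
  have h3 : s ≤ q (∑ i, (starRingEnd ℂ) (φ (f i)) • f i) := by
    refine le_trans ?_ (hφ _)
    rw [h2, Complex.norm_real, Real.norm_of_nonneg hs0]
  simp only [RCLike.norm_conj] at h1
  rw [← hs] at h1
  have h4 : s ^ 2 ≤ K * s := (pow_le_pow_left₀ hs0 h3 2).trans h1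
  rcases hs0.eq_or_lt with h0 | h0
  · rw [← h0]; exact hK
  · nlinarith

/-- The seminorm is the L²(μ) norm of `t ↦ φ t f`. On a probability space it lies between the L¹
norm, which dominates `p`, and the uniform bound `q`; integrating the inequality for a single
functional over `t` gives the summing property. -/
theorem AbsDominated.exists_hilbertian {p q : Seminorm ℂ E} (hpq : AbsDominated p q) :
    ∃ h : Seminorm ℂ E, IsHilbertianSeminorm h ∧ p ≤ h ∧ h ≤ q ∧ SqSumming h q := by
  obtain ⟨T, _, μ, _, φ, hmeas, hbd, hp⟩ := hpq
  have hmem : ∀ f, MemLp (fun t => φ t f) 2 μ := fun f =>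
    MemLp.of_bound (hmeas f).aestronglyMeasurable (q f) (Eventually.of_forall fun t => hbd t f)
  let Φ : E →ₗ[ℂ] Lp ℂ 2 μ :=
    { toFun := fun f => (hmem f).toLp
      map_add' := fun f g => by
        rw [← MemLp.toLp_add]
        exact MemLp.toLp_congr _ _ (Eventually.of_forall fun t => map_add (φ t) f g)
      map_smul' := fun c f => by
        rw [RingHom.id_apply, ← MemLp.toLp_const_smul]
        exact MemLp.toLp_congr _ _ (Eventually.of_forall fun t => map_smul (φ t) c f) }
  have hnorm : ∀ f, ENNReal.ofReal ‖Φ f‖ = eLpNorm (fun t => φ t f) 2 μ := fun f => by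
    change ENNReal.ofReal ‖(hmem f).toLp‖ = _
    rw [Lp.norm_toLp, ENNReal.ofReal_toReal (hmem f).eLpNorm_ne_top]
  have hsq : ∀ f, ENNReal.ofReal (‖Φ f‖ ^ 2) = ∫⁻ t, ENNReal.ofReal (‖φ t f‖ ^ 2) ∂μ := fun f => by
    rw [ENNReal.ofReal_pow (norm_nonneg _), hnorm]
    have := eLpNorm_nnreal_pow_eq_lintegral (p := 2) (μ := μ) (f := fun t => φ t f) (by simp)
    simp only [NNReal.coe_ofNat, ENNReal.rpow_ofNat, ENNReal.coe_ofNat] at this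
    rw [this]
    refine lintegral_congr fun t => ?_
    rw [ENNReal.ofReal_pow (norm_nonneg _), ofReal_norm]
  refine ⟨(normSeminorm ℂ (Lp ℂ 2 μ)).comp Φ, fun f g => ?_, fun f => ?_, fun f => ?_,
    fun ι _ f K hK hf => ?_⟩
  · simp only [Seminorm.comp_apply, coe_normSeminorm, map_add, map_sub]
    simpa only [sq] using parallelogram_law_with_norm ℂ (Φ f) (Φ g)
  · change p f ≤ ‖Φ f‖
    rw [← ENNReal.ofReal_le_ofReal_iff (norm_nonneg _), hnorm]
    refine (hp f).trans ?_
    rw [← eLpNorm_one_eq_lintegral_enorm]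
    exact eLpNorm_le_eLpNorm_of_exponent_le (by norm_num) (hmeas f).aestronglyMeasurable
  · change ‖Φ f‖ ≤ q f
    rw [← ENNReal.ofReal_le_ofReal_iff (apply_nonneg _ _), hnorm]
    refine (eLpNorm_le_of_ae_bound (Eventually.of_forall fun t => hbd t f)).trans ?_
    simp
  · change ∑ i, ‖Φ (f i)‖ ^ 2 ≤ K
    rw [← ENNReal.ofReal_le_ofReal_iff hK, ENNReal.ofReal_sum_of_nonneg fun i _ => by positivity]
    simp only [hsq]
    rw [← lintegral_finsetSum _ fun i _ =>
      ((hmeas (f i)).norm.pow_const 2).ennreal_ofReal]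
    calc ∫⁻ t, ∑ i, ENNReal.ofReal (‖φ t (f i)‖ ^ 2) ∂μ
        ≤ ∫⁻ _, ENNReal.ofReal K ∂μ := lintegral_mono fun t => by
          rw [← ENNReal.ofReal_sum_of_nonneg fun i _ => by positivity]
          exact ENNReal.ofReal_le_ofReal (sum_norm_sq_apply_le (φ t) (hbd t) f hK hf)
      _ = ENNReal.ofReal K := by simp

/-! ### Local Banach spaces of Hilbertian seminorms -/

theorem norm_coe_localBanachSpace (p : Seminorm ℂ E) (f : SeminormCopy p) :
    ‖(f : LocalBanachSpace p)‖ = p f :=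
  UniformSpace.Completion.norm_coe f

theorem linkingMap_coe {p q : Seminorm ℂ E} (h : p ≤ q) (f : SeminormCopy q) :
    linkingMap h (f : LocalBanachSpace q) = (seminormCopyMap h f : LocalBanachSpace p) :=
  ContinuousLinearMap.completion_apply_coe _ _

theorem linkingMap_comp {p q r : Seminorm ℂ E} (h₁ : p ≤ q) (h₂ : q ≤ r) :
    (linkingMap h₁).comp (linkingMap h₂) = linkingMap (h₁.trans h₂) := by
  ext x
  refine UniformSpace.Completion.induction_on x
    (isClosed_eq (ContinuousLinearMap.continuous _) (ContinuousLinearMap.continuous _)) fun f => ?_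
  rw [ContinuousLinearMap.comp_apply, linkingMap_coe, linkingMap_coe, linkingMap_coe]
  rfl

theorem IsHilbertianSeminorm.innerProductSpaceable {h : Seminorm ℂ E}
    (hh : IsHilbertianSeminorm h) : InnerProductSpaceable (LocalBanachSpace h) where
  parallelogram_identity x y := by
    refine UniformSpace.Completion.induction_on₂ x y
      (isClosed_eq (by fun_prop) (by fun_prop)) fun f g => ?_
    rw [← UniformSpace.Completion.coe_add, ← UniformSpace.Completion.coe_sub]
    simp only [norm_coe_localBanachSpace]
    exact hh f g

/-- The linear map `c ↦ ∑ i, c i • x i`, depending continuously on `x`. -/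
noncomputable def synthesisMap {ι : Type*} [Fintype ι] {X : Type*} [NormedAddCommGroup X] [NormedSpace ℂ X]
    (x : ι → X) : EuclideanSpace ℂ ι →L[ℂ] X :=
  ∑ i, ContinuousLinearMap.smulRightL ℂ (EuclideanSpace ℂ ι) X (EuclideanSpace.proj i) (x i)

theorem synthesisMap_apply {ι : Type*} [Fintype ι] {X : Type*} [NormedAddCommGroup X]
    [NormedSpace ℂ X] (x : ι → X) (c : EuclideanSpace ℂ ι) :
    synthesisMap x c = ∑ i, c i • x i := by
  simp [synthesisMap]

theorem continuous_synthesisMap {ι : Type*} [Fintype ι] {X : Type*} [NormedAddCommGroup X]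
    [NormedSpace ℂ X] :
    Continuous (synthesisMap : (ι → X) → EuclideanSpace ℂ ι →L[ℂ] X) := by
  unfold synthesisMap
  fun_prop

/-- For families from `E` this is the summing property with `K = ‖synthesisMap x‖²`. Both sides are
continuous in `x`, so density carries it to the completion. -/
theorem SqSumming.sum_norm_linkingMap_le {p q : Seminorm ℂ E} (hpq : p ≤ q) (h : SqSumming p q)
    {ι : Type u} [Fintype ι] (x : ι → LocalBanachSpace q) :
    ∑ i, ‖linkingMap hpq (x i)‖ ^ 2 ≤ ‖synthesisMap x‖ ^ 2 := by
  have hd : DenseRange (Pi.map fun (_ : ι) (f : SeminormCopy q) => (f : LocalBanachSpace q)) :=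
    DenseRange.piMap fun _ => UniformSpace.Completion.denseRange_coe
  refine hd.induction_on (p := fun x => ∑ i, ‖linkingMap hpq (x i)‖ ^ 2 ≤ ‖synthesisMap x‖ ^ 2) x
    (isClosed_le (by fun_prop) (continuous_synthesisMap.norm.pow 2)) fun f => ?_
  simp only [Pi.map_apply, linkingMap_coe, norm_coe_localBanachSpace]
  refine h ι f _ (sq_nonneg _) fun c => ?_
  have h1 := (synthesisMap (Pi.map (fun (_ : ι) (f : SeminormCopy q) =>
    (f : LocalBanachSpace q)) f)).le_opNorm (WithLp.toLp 2 c)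
  have h2 : synthesisMap (Pi.map (fun (_ : ι) (f : SeminormCopy q) =>
      (f : LocalBanachSpace q)) f) (WithLp.toLp 2 c) =
      ((∑ i, c i • f i : SeminormCopy q) : LocalBanachSpace q) := by
    rw [synthesisMap_apply]
    refine Eq.trans ?_ (map_sum (UniformSpace.Completion.toComplL (𝕜 := ℂ) (E := SeminormCopy q))
      (fun i => c i • f i) _).symm
    exact Finset.sum_congr rfl fun i _ => (map_smul
      (UniformSpace.Completion.toComplL (𝕜 := ℂ) (E := SeminormCopy q)) (c i) (f i)).symm
  rw [h2, norm_coe_localBanachSpace] at h1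
  refine (pow_le_pow_left₀ (apply_nonneg _ _) h1 2).trans_eq ?_
  rw [mul_pow, EuclideanSpace.norm_sq_eq]

end Hilbertian

/-! ### Nuclearity of compositions of Hilbert–Schmidt type maps -/

section Nuclear

/-- A summable family has countable support, and where `‖f i‖ * ‖y i‖ = 0` the term of the expansion
vanishes too; the support embeds into `ℕ` and the rest is filled with zeros. -/
theorem isNuclearOperator_of_hasSum {X Y ι : Type*} [NormedAddCommGroup X] [NormedSpace ℂ X]
    [NormedAddCommGroup Y] [NormedSpace ℂ Y] {T : X →L[ℂ] Y} (f : ι → X →L[ℂ] ℂ) (y : ι → Y)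
    (hs : Summable fun i => ‖f i‖ * ‖y i‖) (hT : ∀ x, HasSum (fun i => f i x • y i) (T x)) :
    IsNuclearOperator T := by
  set s : Set ι := Function.support fun i => ‖f i‖ * ‖y i‖ with hsdef
  have hc : s.Countable := hs.countable_support
  obtain ⟨e, he⟩ := hc.exists_injective_nat
  have hout : ∀ i ∉ s, ∀ x, f i x • y i = 0 := fun i hi x => by
    rw [hsdef, Function.notMem_support, mul_eq_zero, norm_eq_zero, norm_eq_zero] at hi
    rcases hi with h | h <;> simp [h]
  have hsub : Summable fun i : s => ‖f i‖ * ‖y i‖ := hs.subtype s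
  have hTsub : ∀ x, HasSum (fun i : s => f i x • y i) (T x) := fun x =>
    (hasSum_subtype_iff_of_support_subset fun i hi => by
      by_contra h
      exact hi (hout i h x)).2 (hT x)
  refine ⟨Function.extend e (fun i : s => f i) 0, Function.extend e (fun i : s => y i) 0, ?_,
    fun x => ?_⟩
  · refine (he.summable_iff fun n hn => ?_).1 ?_
    · rw [Function.extend_apply' _ _ _ fun ⟨i, hi⟩ => hn ⟨i, hi⟩]
      simp
    · refine hsub.congr fun i => ?_
      simp [he.extend_apply]
  · refine (he.hasSum_iff fun n hn => ?_).1 ?_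
    · rw [Function.extend_apply' _ _ _ fun ⟨i, hi⟩ => hn ⟨i, hi⟩]
      simp
    · convert hTsub x using 2 with i
      simp [he.extend_apply]

theorem IsNuclearOperator.comp {X Y Z : Type*} [NormedAddCommGroup X] [NormedSpace ℂ X]
    [NormedAddCommGroup Y] [NormedSpace ℂ Y] [NormedAddCommGroup Z] [NormedSpace ℂ Z]
    {T : Y →L[ℂ] Z} (hT : IsNuclearOperator T) (S : X →L[ℂ] Y) : IsNuclearOperator (T.comp S) := by
  obtain ⟨f, y, hs, hf⟩ := hT
  refine ⟨fun n => (f n).comp S, y, ?_, fun x => hf (S x)⟩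
  refine Summable.of_nonneg_of_le (fun n => by positivity) (fun n => ?_) (hs.mul_right ‖S‖)
  calc ‖(f n).comp S‖ * ‖y n‖ ≤ ‖f n‖ * ‖S‖ * ‖y n‖ := by
        gcongr
        exact (f n).opNorm_comp_le S
    _ = ‖f n‖ * ‖y n‖ * ‖S‖ := by ring

universe u

/-- The composition of two maps that are square summable on orthonormal families is nuclear. -/
theorem isNuclearOperator_comp_of_orthonormal {H₂ H₁ : Type u} {Y : Type*}
    [NormedAddCommGroup H₂] [InnerProductSpace ℂ H₂] [CompleteSpace H₂]
    [NormedAddCommGroup H₁] [InnerProductSpace ℂ H₁] [CompleteSpace H₁]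
    [NormedAddCommGroup Y] [NormedSpace ℂ Y] (T : H₂ →L[ℂ] H₁) (S : H₁ →L[ℂ] Y) {C : ℝ}
    (hT : ∀ (ι : Type u) [Fintype ι] (v : ι → H₂), Orthonormal ℂ v → ∑ i, ‖T (v i)‖ ^ 2 ≤ C)
    (hS : ∀ (ι : Type u) [Fintype ι] (v : ι → H₁), Orthonormal ℂ v → ∑ i, ‖S (v i)‖ ^ 2 ≤ C) :
    IsNuclearOperator (S.comp T) := by
  obtain ⟨w₁, e, -⟩ := exists_hilbertBasis ℂ H₁
  obtain ⟨w₂, b, -⟩ := exists_hilbertBasis ℂ H₂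
  have hsumS : Summable fun i => ‖S (e i)‖ ^ 2 :=
    summable_of_sum_le (c := C) (fun i => by positivity) fun F => by
      rw [← Finset.sum_coe_sort]
      exact hS F (fun i => e i) (e.orthonormal.comp _ Subtype.val_injective)
  have hsumT : Summable fun j => ‖T (b j)‖ ^ 2 :=
    summable_of_sum_le (c := C) (fun i => by positivity) fun F => by
      rw [← Finset.sum_coe_sort]
      exact hT F (fun i => b i) (b.orthonormal.comp _ Subtype.val_injective)
  have hparseval : ∀ x : H₂, HasSum (fun j => ‖inner ℂ x (b j)‖ ^ 2) (‖x‖ ^ 2) := fun x => by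
    have h := b.hasSum_inner_mul_inner x x
    have h' := Complex.hasSum_re h
    convert h' using 1
    · funext j
      rw [← inner_conj_symm (b j) x, Complex.mul_conj', ← Complex.ofReal_pow, Complex.ofReal_re]
    · rw [inner_self_eq_norm_sq_to_K]
      norm_cast
  -- The adjoint is again Hilbert–Schmidt: expand `T* e i` in the basis `b`, exchange the sums, and
  -- apply Bessel's inequality to each `T (b j)`.
  have hadj : Summable fun i => ‖T.adjoint (e i)‖ ^ 2 := by
    refine summable_of_sum_le (c := ∑' j, ‖T (b j)‖ ^ 2) (fun i => by positivity) fun F => ?_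
    have h1 := hasSum_sum (s := F) fun i _ => hparseval (T.adjoint (e i))
    refine hasSum_le (fun j => ?_) h1 hsumT.hasSum
    simp only [ContinuousLinearMap.adjoint_inner_left]
    exact e.orthonormal.sum_inner_products_le (T (b j))
  -- Applying `S` to the expansion of `T x` in the basis `e` gives `S T x = ∑ ⟪T* e i, x⟫ S (e i)`.
  refine isNuclearOperator_of_hasSum (fun i => innerSL ℂ (T.adjoint (e i))) (fun i => S (e i)) ?_
    fun x => ?_
  · refine Summable.of_nonneg_of_le (fun i => by positivity) (fun i => ?_) (hadj.add hsumS)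
    rw [innerSL_apply_norm]
    nlinarith [sq_nonneg (‖T.adjoint (e i)‖ - ‖S (e i)‖), sq_nonneg ‖T.adjoint (e i)‖,
      sq_nonneg ‖S (e i)‖]
  · have h := (e.hasSum_repr (T x)).mapL S
    convert h using 2 with i
    · rw [map_smul, innerSL_apply_apply, ContinuousLinearMap.adjoint_inner_left,
        e.repr_apply_apply]
    · rfl

theorem norm_synthesisMap_le_of_orthonormal {ι : Type*} [Fintype ι] {H : Type*}
    [NormedAddCommGroup H] [InnerProductSpace ℂ H] {v : ι → H} (hv : Orthonormal ℂ v) :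
    ‖synthesisMap v‖ ≤ 1 := by
  refine ContinuousLinearMap.opNorm_le_bound _ zero_le_one fun c => ?_
  rw [synthesisMap_apply, one_mul, ← sq_le_sq₀ (norm_nonneg _) (norm_nonneg _),
    EuclideanSpace.norm_sq_eq]
  rw [← inner_self_eq_norm_sq (𝕜 := ℂ), hv.inner_sum, map_sum]
  refine (Finset.sum_congr rfl fun i _ => ?_).le
  rw [Complex.conj_mul', ← Complex.ofReal_pow]
  exact Complex.ofReal_re _

variable {E : Type u} [AddCommGroup E] [Module ℂ E]

/-- The parallelogram identity makes both local spaces Hilbert spaces. Synthesis from an orthonormal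
family has norm at most one, so both links satisfy the orthonormal bound with `C = 1`. -/
theorem isNuclearOperator_linkingMap_of_sqSumming {p h₁ h₂ : Seminorm ℂ E}
    (hh₁ : IsHilbertianSeminorm h₁) (hh₂ : IsHilbertianSeminorm h₂) (hp : p ≤ h₁) (h₁₂ : h₁ ≤ h₂)
    (hs₁ : SqSumming p h₁) (hs₂ : SqSumming h₁ h₂) :
    IsNuclearOperator (linkingMap (hp.trans h₁₂)) := by
  let : InnerProductSpace ℂ (LocalBanachSpace h₁) :=
    InnerProductSpace.ofNorm ℂ hh₁.innerProductSpaceable.parallelogram_identity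
  let : InnerProductSpace ℂ (LocalBanachSpace h₂) :=
    InnerProductSpace.ofNorm ℂ hh₂.innerProductSpaceable.parallelogram_identity
  rw [← linkingMap_comp hp h₁₂]
  refine isNuclearOperator_comp_of_orthonormal (linkingMap h₁₂) (linkingMap hp) (C := 1)
    (fun ι _ v hv => (hs₂.sum_norm_linkingMap_le h₁₂ v).trans ?_)
    (fun ι _ v hv => (hs₁.sum_norm_linkingMap_le hp v).trans ?_)
  · exact pow_le_one₀ (norm_nonneg _) (norm_synthesisMap_le_of_orthonormal hv)
  · exact pow_le_one₀ (norm_nonneg _) (norm_synthesisMap_le_of_orthonormal hv)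

theorem AbsDominated.isNuclearOperator_linkingMap {p₀ p₁ p₂ p₃ : Seminorm ℂ E}
    (h₀₁ : AbsDominated p₀ p₁) (h₁₂ : AbsDominated p₁ p₂) (h₂₃ : AbsDominated p₂ p₃) :
    ∃ h : p₀ ≤ p₃, IsNuclearOperator (linkingMap h) := by
  obtain ⟨g₀, -, h0, h0', hs0⟩ := h₀₁.exists_hilbertian
  obtain ⟨g₁, hg₁, h1, h1', hs1⟩ := h₁₂.exists_hilbertian
  obtain ⟨g₂, hg₂, h2, h2', -⟩ := h₂₃.exists_hilbertian
  -- The chain is `p₀ ≤ g₀ ≤ p₁ ≤ g₁ ≤ p₂ ≤ g₂ ≤ p₃`. The links `g₂ → g₁` and `g₁ → p₀` are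
  -- 2-summing and start from Hilbert spaces; the link `p₃ → g₂` need only be bounded.
  have hp := h0.trans (h0'.trans h1)
  have h12 := h1'.trans h2
  refine ⟨(hp.trans h12).trans h2', ?_⟩
  rw [← linkingMap_comp (hp.trans h12) h2']
  exact (isNuclearOperator_linkingMap_of_sqSumming hg₁ hg₂ hp h12 (hs0.mono h0 h1)
    (hs1.mono le_rfl h2)).comp _

end Nuclear

/-! ### Partial derivatives -/

section PartialDerivatives

variable {d : ℕ} {f : EuclideanSpace ℝ (Fin d) → ℂ}

theorem partialD_comm (hf : ContDiff ℝ ∞ f) (i k : Fin d) :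
    partialD i (partialD k f) = partialD k (partialD i f) := by
  have key : ∀ i k : Fin d, ∀ x, partialD i (partialD k f) x =
      fderiv ℝ (fderiv ℝ f) x (EuclideanSpace.single i 1) (EuclideanSpace.single k 1) := by
    intro i k x
    have hd : DifferentiableAt ℝ (fderiv ℝ f) x :=
      ((hf.fderiv_right (m := ∞) (by simp)).differentiable (by simp)) x
    change fderiv ℝ (fun y => fderiv ℝ f y (EuclideanSpace.single k 1)) x _ = _
    rw [fderiv_clm_apply hd (differentiableAt_const _)]
    simp
  funext x
  rw [key, key]
  exact hf.contDiffAt.isSymmSndFDerivAt (by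
    rw [minSmoothness_of_isRCLikeNormedField]
    exact WithTop.coe_le_coe.2 (le_top : (2 : ℕ∞) ≤ ⊤)) _ _

theorem contDiff_iterate_partialD (hf : ContDiff ℝ ∞ f) (i : Fin d) (n : ℕ) :
    ContDiff ℝ ∞ ((partialD i)^[n] f) :=
  (iterate_partialD i n 0 hf hf).1

theorem contDiff_multiD (hf : ContDiff ℝ ∞ f) (β : Fin d → ℕ) : ContDiff ℝ ∞ (multiD β f) :=
  (foldr_partialD β 0 hf hf _).1

theorem partialD_iterate_comm (hf : ContDiff ℝ ∞ f) (i k : Fin d) (n : ℕ) :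
    (partialD k)^[n] (partialD i f) = partialD i ((partialD k)^[n] f) := by
  induction n with
  | zero => rfl
  | succ n ih =>
    rw [Function.iterate_succ_apply', Function.iterate_succ_apply', ih,
      partialD_comm (contDiff_iterate_partialD hf k n)]

theorem foldr_partialD_add_single_of_notMem (β : Fin d → ℕ) (i : Fin d) (l : List (Fin d))
    (hi : i ∉ l) :
    l.foldr (fun k g => (partialD k)^[(β + Pi.single i 1 : Fin d → ℕ) k] g) f =
      l.foldr (fun k g => (partialD k)^[β k] g) f := by
  induction l with
  | nil => rfl
  | cons k l ih =>
    rw [List.mem_cons, not_or] at hi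
    rw [List.foldr_cons, List.foldr_cons, ih hi.2, Pi.add_apply, Pi.single_eq_of_ne' hi.1,
      add_zero]

/-- The extra `∂ᵢ` is moved to the front through the other partial derivatives, which commute with
it. Without repetitions in `l`, it occurs exactly once. -/
theorem foldr_partialD_add_single (hf : ContDiff ℝ ∞ f) (β : Fin d → ℕ) (i : Fin d)
    (l : List (Fin d)) (hl : l.Nodup) (hi : i ∈ l) :
    l.foldr (fun k g => (partialD k)^[(β + Pi.single i 1 : Fin d → ℕ) k] g) f =
      partialD i (l.foldr (fun k g => (partialD k)^[β k] g) f) := by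
  induction l with
  | nil => simp at hi
  | cons k l ih =>
    rw [List.nodup_cons] at hl
    rw [List.foldr_cons, List.foldr_cons]
    rcases eq_or_ne i k with rfl | hik
    · rw [foldr_partialD_add_single_of_notMem β i l hl.1, Pi.add_apply, Pi.single_eq_same,
        Function.iterate_succ_apply']
    · rw [ih hl.2 ((List.mem_cons.1 hi).resolve_left hik),
        partialD_iterate_comm (foldr_partialD β 0 hf hf l).1, Pi.add_apply,
        Pi.single_eq_of_ne' hik, add_zero]

theorem multiD_add_single (hf : ContDiff ℝ ∞ f) (β : Fin d → ℕ) (i : Fin d) :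
    multiD (β + Pi.single i 1) f = partialD i (multiD β f) :=
  foldr_partialD_add_single hf β i _ (List.nodup_finRange d) (List.mem_finRange i)

theorem hasDerivAt_comp_update {g : EuclideanSpace ℝ (Fin d) → ℂ} (hg : ContDiff ℝ ∞ g)
    (z : Fin d → ℝ) (i : Fin d) (s : ℝ) :
    HasDerivAt (fun s => g (WithLp.toLp 2 (Function.update z i s)))
      (partialD i g (WithLp.toLp 2 (Function.update z i s))) s := by
  have h1 := ((EuclideanSpace.equiv (Fin d) ℝ).symm.hasFDerivAt
    (x := Function.update z i s)).comp_hasDerivAt s (hasDerivAt_update z i s)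
  exact (hg.differentiable (by simp) _).hasFDerivAt.comp_hasDerivAt s h1

end PartialDerivatives

/-! ### Pointwise bounds by integrals of derivatives -/

section Sobolev

open ProbabilityTheory

/-- `u x` is minus the integral of `u'` over `(x, ∞)`, where `s ^ a ≥ x ^ a`. -/
theorem enorm_pow_mul_le_lintegral_of_nonneg {u u' : ℝ → ℂ} (hu : ∀ s, HasDerivAt u (u' s) s)
    (hu' : Continuous u') (htop : Tendsto u atTop (𝓝 0)) {x : ℝ} (hx : 0 ≤ x) (a : ℕ) :
    ‖x ^ a‖ₑ * ‖u x‖ₑ ≤ ∫⁻ s, ‖s ^ a‖ₑ * ‖u' s‖ₑ := by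
  have hlim : Tendsto (fun b => ‖x ^ a‖ₑ * ‖u b - u x‖ₑ) atTop (𝓝 (‖x ^ a‖ₑ * ‖0 - u x‖ₑ)) :=
    ENNReal.Tendsto.const_mul (htop.sub_const (u x)).enorm (Or.inr enorm_ne_top)
  rw [zero_sub, enorm_neg] at hlim
  refine le_of_tendsto hlim ((eventually_ge_atTop x).mono fun b hb => ?_)
  rw [← intervalIntegral.integral_eq_sub_of_hasDerivAt (fun s _ => hu s)
    (hu'.intervalIntegrable x b), intervalIntegral.integral_of_le hb]
  calc ‖x ^ a‖ₑ * ‖∫ s in Set.Ioc x b, u' s‖ₑ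
      ≤ ‖x ^ a‖ₑ * ∫⁻ s in Set.Ioc x b, ‖u' s‖ₑ := by
        gcongr
        exact enorm_integral_le_lintegral_enorm _
    _ = ∫⁻ s in Set.Ioc x b, ‖x ^ a‖ₑ * ‖u' s‖ₑ := (lintegral_const_mul' _ _ enorm_ne_top).symm
    _ ≤ ∫⁻ s in Set.Ioc x b, ‖s ^ a‖ₑ * ‖u' s‖ₑ := by
        refine setLIntegral_mono' measurableSet_Ioc fun s hs => ?_
        gcongr
        rw [enorm_le_iff_norm_le, Real.norm_of_nonneg (by positivity),
          Real.norm_of_nonneg (pow_nonneg (hx.trans hs.1.le) a)]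
        exact pow_le_pow_left₀ hx hs.1.le a
    _ ≤ ∫⁻ s, ‖s ^ a‖ₑ * ‖u' s‖ₑ := setLIntegral_le_lintegral _ _

theorem enorm_pow_mul_le_lintegral {u u' : ℝ → ℂ} (hu : ∀ s, HasDerivAt u (u' s) s)
    (hu' : Continuous u') (hlim : Tendsto u (cocompact ℝ) (𝓝 0)) (x : ℝ) (a : ℕ) :
    ‖x ^ a‖ₑ * ‖u x‖ₑ ≤ ∫⁻ s, ‖s ^ a‖ₑ * ‖u' s‖ₑ := by
  rw [cocompact_eq_atBot_atTop, tendsto_sup] at hlim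
  rcases le_total 0 x with hx | hx
  · exact enorm_pow_mul_le_lintegral_of_nonneg hu hu' hlim.2 hx a
  · have h := enorm_pow_mul_le_lintegral_of_nonneg (u := fun s => u (-s))
      (u' := fun s => -u' (-s)) (fun s => by
        simpa [Function.comp_def] using (hu (-s)).scomp s (hasDerivAt_neg s))
      (hu'.comp continuous_neg).neg (hlim.1.comp tendsto_neg_atTop_atBot) (neg_nonneg.2 hx) a
    rw [← lintegral_neg_eq_self] at h
    simpa [enorm_pow, enorm_neg] using h

theorem lintegral_eq_lintegral_cauchyMeasure {g : ℝ → ℝ≥0∞} (hg : Measurable g) :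
    ∫⁻ s, g s = ∫⁻ s, ‖Real.pi * (1 + s ^ 2)‖ₑ * g s ∂cauchyMeasure 0 1 := by
  rw [cauchyMeasure_of_scale_ne_zero 0 one_ne_zero,
    lintegral_withDensity_eq_lintegral_mul _ (measurable_cauchyPDF 0 1) (by fun_prop)]
  refine lintegral_congr fun s => ?_
  have h : 0 < Real.pi * (1 + s ^ 2) := by positivity
  rw [Pi.mul_apply, ← mul_assoc, cauchyPDF_def, cauchyPDFReal_def, Real.enorm_of_nonneg h.le,
    ← ENNReal.ofReal_mul (by positivity)]
  have h1 : Real.pi⁻¹ * ((1 : NNReal) : ℝ) * ((s - 0) ^ 2 + ((1 : NNReal) : ℝ) ^ 2)⁻¹ *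
      (Real.pi * (1 + s ^ 2)) = 1 := by
    have : (1 + s ^ 2) ≠ 0 := by positivity
    rw [NNReal.coe_one, sub_zero, one_pow, add_comm (s ^ 2)]
    field_simp
  rw [h1, ENNReal.ofReal_one, one_mul]

variable {d : ℕ} {f : EuclideanSpace ℝ (Fin d) → ℂ}

/-- The integrand bounding `x ^ α * multiD β f x` after integration over the variables in `S`. -/
noncomputable def sobolevIntegrand (f : EuclideanSpace ℝ (Fin d) → ℂ) (α β : Fin d → ℕ) (S : Finset (Fin d))
    (x : Fin d → ℝ) : ℝ≥0∞ :=
  ‖∏ k, ((if k ∈ S then Real.pi * (1 + x k ^ 2) else 1) * x k ^ α k)‖ₑ *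
    ‖multiD (β + fun k => if k ∈ S then 1 else 0) f (WithLp.toLp 2 x)‖ₑ

theorem measurable_sobolevIntegrand (hf : ContDiff ℝ ∞ f) (α β : Fin d → ℕ)
    (S : Finset (Fin d)) : Measurable (sobolevIntegrand f α β S) := by
  have h1 : Continuous fun x : Fin d → ℝ =>
      multiD (β + fun k => if k ∈ S then 1 else 0) f (WithLp.toLp 2 x) :=
    (contDiff_multiD hf _).continuous.comp (PiLp.continuous_toLp 2 _)
  have h2 : Continuous fun x : Fin d → ℝ =>
      ∏ k, ((if k ∈ S then Real.pi * (1 + x k ^ 2) else 1) * x k ^ α k) := by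
    refine continuous_finsetProd _ fun k _ => ?_
    split_ifs <;> fun_prop
  exact h2.enorm.measurable.mul h1.enorm.measurable

/-- The one-variable bound is applied to `D^γ f` in the coordinate `i`; the factors in the other
coordinates form a constant `P`. -/
theorem sobolevIntegrand_le_lintegral (hf : ContDiff ℝ ∞ f)
    (hlim : ∀ (γ : Fin d → ℕ) (i : Fin d) (x : Fin d → ℝ),
      Tendsto (fun s => multiD γ f (WithLp.toLp 2 (Function.update x i s))) (cocompact ℝ) (𝓝 0))
    (α β : Fin d → ℕ) {S : Finset (Fin d)} {i : Fin d} (hi : i ∉ S) (z : Fin d → ℝ) :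
    sobolevIntegrand f α β S z ≤
      ∫⁻ s, sobolevIntegrand f α β (insert i S) (Function.update z i s) ∂cauchyMeasure 0 1 := by
  set γ : Fin d → ℕ := β + fun k => if k ∈ S then 1 else 0 with hγ
  have hγ' : (β + fun k => if k ∈ insert i S then 1 else 0) = γ + Pi.single i 1 := by
    funext k
    rcases eq_or_ne k i with rfl | hk
    · simp [hγ, hi]
    · simp [hγ, hk]
  set P : ℝ := ∏ k ∈ Finset.univ.erase i,
    ((if k ∈ S then Real.pi * (1 + z k ^ 2) else 1) * z k ^ α k) with hP
  have hcont : Continuous fun s =>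
      partialD i (multiD γ f) (WithLp.toLp 2 (Function.update z i s)) :=
    (partialD_contDiff (contDiff_multiD hf γ) i).continuous.comp
      ((PiLp.continuous_toLp 2 _).comp (continuous_const.update i continuous_id))
  have h1 := enorm_pow_mul_le_lintegral (hasDerivAt_comp_update (contDiff_multiD hf γ) z i)
    hcont (hlim γ i z) (z i) (α i)
  rw [Function.update_eq_self, lintegral_eq_lintegral_cauchyMeasure
    (Measurable.fun_mul (by fun_prop) hcont.enorm.measurable)] at h1
  calc sobolevIntegrand f α β S z
      = ‖P‖ₑ * (‖z i ^ α i‖ₑ * ‖multiD γ f (WithLp.toLp 2 z)‖ₑ) := by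
        rw [sobolevIntegrand, ← hγ, ← Finset.mul_prod_erase _ _ (Finset.mem_univ i), if_neg hi,
          one_mul, enorm_mul, ← hP]
        ring
    _ ≤ ‖P‖ₑ * ∫⁻ s, ‖Real.pi * (1 + s ^ 2)‖ₑ * (‖s ^ α i‖ₑ *
          ‖partialD i (multiD γ f) (WithLp.toLp 2 (Function.update z i s))‖ₑ)
            ∂cauchyMeasure 0 1 := by gcongr
    _ = ∫⁻ s, sobolevIntegrand f α β (insert i S) (Function.update z i s)
          ∂cauchyMeasure 0 1 := by
        rw [← lintegral_const_mul' _ _ enorm_ne_top]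
        refine lintegral_congr fun s => ?_
        rw [sobolevIntegrand, hγ', multiD_add_single hf,
          ← Finset.mul_prod_erase _ _ (Finset.mem_univ i), if_pos (Finset.mem_insert_self i S),
          Function.update_self]
        have : ∏ k ∈ Finset.univ.erase i, ((if k ∈ insert i S then
            Real.pi * (1 + Function.update z i s k ^ 2) else 1) *
            Function.update z i s k ^ α k) = P := by
          refine Finset.prod_congr rfl fun k hk => ?_
          have hk' := Finset.ne_of_mem_erase hk
          simp [hk']
        rw [this, enorm_mul _ P, enorm_mul (Real.pi * (1 + s ^ 2))]
        ring

theorem enorm_monomial_mul_multiD_le (hf : ContDiff ℝ ∞ f)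
    (hlim : ∀ (γ : Fin d → ℕ) (i : Fin d) (x : Fin d → ℝ),
      Tendsto (fun s => multiD γ f (WithLp.toLp 2 (Function.update x i s))) (cocompact ℝ) (𝓝 0))
    (α β : Fin d → ℕ) (x : Fin d → ℝ) :
    ‖∏ k, x k ^ α k‖ₑ * ‖multiD β f (WithLp.toLp 2 x)‖ₑ ≤
      ∫⁻ y, ‖∏ k, (Real.pi * (1 + y k ^ 2) * y k ^ α k)‖ₑ *
        ‖multiD (β + 1) f (WithLp.toLp 2 y)‖ₑ
          ∂Measure.pi fun _ : Fin d => cauchyMeasure 0 1 := by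
  have key : ∀ S : Finset (Fin d), sobolevIntegrand f α β ∅ ≤
      ∫⋯∫⁻_S, sobolevIntegrand f α β S ∂fun _ : Fin d => cauchyMeasure 0 1 := by
    intro S
    induction S using Finset.induction_on with
    | empty => rw [lmarginal_empty]
    | insert i S hi ih =>
      rw [lmarginal_insert' _ (measurable_sobolevIntegrand hf α β _) hi]
      exact ih.trans (lmarginal_mono fun z => sobolevIntegrand_le_lintegral hf hlim α β hi z)
  have h := key Finset.univ x
  rw [lmarginal_univ] at h
  have h0 : (β + fun _ => 0) = β := by ext; simp
  have h1 : (β + fun _ => 1) = β + 1 := rfl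
  simp only [sobolevIntegrand, Finset.notMem_empty, if_false, one_mul, Finset.mem_univ, if_true,
    h0, h1] at h
  exact h

end Sobolev

/-! ### Growth of the weight sequence -/

theorem CondM2'.exists_shift_le {M : ℕ → ℝ} (hpos : ∀ p, 0 < M p) (hM : CondM2' M) (m₀ : ℕ) :
    ∃ B ≥ (1 : ℝ), ∃ K ≥ (1 : ℝ), ∀ m ≤ m₀, ∀ N, M (N + m) ≤ B * K ^ N * M N := by
  obtain ⟨A, -, H, hH, hAH⟩ := hM
  -- Enlarging the constants to at least one makes the bounds monotone in them, so a single pair `B,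
  -- K` serves all `m ≤ m₀`.
  have hstep : ∀ p, M (p + 1) ≤ max A 1 * max H 1 ^ p * M p := fun p => by
    refine (hAH p).trans (mul_le_mul_of_nonneg_right ?_ (hpos p).le)
    gcongr <;> exact le_max_left _ _
  have hA1 : 1 ≤ max A 1 := le_max_right _ _
  have hH1 : 1 ≤ max H 1 := le_max_right _ _
  generalize max A 1 = A at *
  generalize max H 1 = H at *
  induction m₀ with
  | zero =>
    refine ⟨1, le_rfl, 1, le_rfl, fun m hm N => ?_⟩
    rw [Nat.le_zero.1 hm]
    simp
  | succ m₀ ih =>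
    obtain ⟨B, hB, K, hK, h⟩ := ih
    have hHm : 1 ≤ H ^ m₀ := one_le_pow₀ hH1
    have hAHm : 1 ≤ A * H ^ m₀ := one_le_mul_of_one_le_of_one_le hA1 hHm
    refine ⟨A * H ^ m₀ * B, one_le_mul_of_one_le_of_one_le hAHm hB, H * K,
      one_le_mul_of_one_le_of_one_le hH1 hK, fun m hm N => ?_⟩
    have hMN := hpos N
    rcases Nat.le_succ_iff.1 hm with hm | rfl
    · refine (h m hm N).trans ?_
      gcongr
      · exact le_mul_of_one_le_left (by positivity) hAHm
      · exact le_mul_of_one_le_left (by positivity) hH1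
    · calc M (N + m₀ + 1) ≤ A * H ^ (N + m₀) * M (N + m₀) := hstep _
        _ ≤ A * H ^ (N + m₀) * (B * K ^ N * M N) := by
          gcongr
          exact h m₀ le_rfl N
        _ = A * H ^ m₀ * B * (H * K) ^ N * M N := by ring

/-! ### Geometric weights on multi-indices -/

section GeometricWeights

open ProbabilityTheory

/-- The geometric distribution with parameter `1 / 2` on each component of a multi-index. -/
noncomputable def multiIndexMeasure (d : ℕ) : Measure (Fin d → ℕ) :=
  Measure.pi fun _ => geometricMeasure ⟨1 / 2, by norm_num, by norm_num⟩

instance (d : ℕ) : IsProbabilityMeasure (multiIndexMeasure d) := by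
  unfold multiIndexMeasure
  infer_instance

theorem multiIndexMeasure_singleton_mul (d : ℕ) (α : Fin d → ℕ) :
    multiIndexMeasure d {α} * ‖∏ i, (2 : ℝ) ^ (α i + 1)‖ₑ = 1 := by
  have h2 : (⟨1 / 2, by norm_num, by norm_num⟩ : unitInterval) ≠ 0 := fun h => by
    have := congrArg Subtype.val h
    norm_num at this
  have hgeo : ∀ n, geometricMeasure (⟨1 / 2, by norm_num, by norm_num⟩ : unitInterval) {n} =
      ENNReal.ofReal ((1 / 2) ^ (n + 1)) := fun n => by
    rw [geometricMeasure_singleton h2]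
    change ENNReal.ofReal ((1 - 1 / 2) ^ n * (1 / 2)) = _
    norm_num [pow_succ]
  rw [multiIndexMeasure, Measure.pi_singleton]
  simp only [hgeo]
  rw [← ENNReal.ofReal_prod_of_nonneg fun i _ => by positivity,
    Real.enorm_of_nonneg (by positivity), ← ENNReal.ofReal_mul (by positivity),
    ← Finset.prod_mul_distrib, Finset.prod_eq_one, ENNReal.ofReal_one]
  intro i _
  rw [← mul_pow]
  norm_num

/-- Keeping one atom of `ν` bounds an integral from below; this is how an average over multi-indices
controls each term of the supremum. -/
theorem measure_singleton_mul_lintegral_le {A B : Type*} [MeasurableSpace A]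
    [MeasurableSingletonClass A] [MeasurableSpace B] (ν : Measure A) (μ : Measure B) [SFinite μ]
    {g : A × B → ℝ≥0∞} (hg : Measurable g) (a : A) :
    ν {a} * ∫⁻ y, g (a, y) ∂μ ≤ ∫⁻ t, g t ∂ν.prod μ := by
  rw [lintegral_prod g hg.aemeasurable, mul_comm,
    ← lintegral_singleton (fun a => ∫⁻ y, g (a, y) ∂μ) a]
  exact setLIntegral_le_lintegral _ _

end GeometricWeights

/-! ### Domination of the defining seminorms -/

namespace UltraSpace

open ProbabilityTheory

variable {M : ℕ → ℝ} {d : ℕ}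

theorem contDiff (f : UltraSpace M d) : ContDiff ℝ ∞ f.toFun := (Subtype.property f).1

theorem toFun_add (f g : UltraSpace M d) : (f + g).toFun = f.toFun + g.toFun := rfl

theorem toFun_smul (c : ℂ) (f : UltraSpace M d) : (c • f).toFun = c • f.toFun := rfl

theorem seminorm_apply (j : ℕ+) (f : UltraSpace M d) :
    seminorm M d j f = ⨆ t, weightedTerm M j f.toFun t := rfl

theorem weightedTerm_le_seminorm (j : ℕ+) (f : UltraSpace M d)
    (t : (Fin d → ℕ) × (Fin d → ℕ) × EuclideanSpace ℝ (Fin d)) :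
    weightedTerm M j f.toFun t ≤ seminorm M d j f :=
  le_ciSup ((Subtype.property f).2 j) t

theorem weightedTerm_eq (hpos : ∀ p, 0 < M p) (j : ℕ+) (f : EuclideanSpace ℝ (Fin d) → ℂ)
    (t : (Fin d → ℕ) × (Fin d → ℕ) × EuclideanSpace ℝ (Fin d)) :
    weightedTerm M j f t = ((j : ℕ) : ℝ) ^ (∑ i, (t.1 i + t.2.1 i)) /
      M (∑ i, (t.1 i + t.2.1 i)) * (|∏ i, t.2.2 i ^ t.1 i| * ‖multiD t.2.1 f t.2.2‖) := by
  have := hpos (∑ i, (t.1 i + t.2.1 i))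
  rw [weightedTerm, norm_smul, Real.norm_eq_abs, abs_div, abs_mul, abs_of_pos this,
    abs_of_nonneg (by positivity : (0 : ℝ) ≤ ((j : ℕ) : ℝ) ^ _)]
  ring

theorem seminorm_mono (hpos : ∀ p, 0 < M p) {j k : ℕ+} (hjk : j ≤ k) :
    seminorm M d j ≤ seminorm M d k := fun f => by
  rw [seminorm_apply]
  refine ciSup_le fun t => le_trans ?_ (weightedTerm_le_seminorm k f t)
  have := hpos (∑ i, (t.1 i + t.2.1 i))
  have hjk' : ((j : ℕ) : ℝ) ≤ ((k : ℕ) : ℝ) := by exact_mod_cast hjk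
  rw [weightedTerm_eq hpos, weightedTerm_eq hpos]
  gcongr

/-- The term of the seminorm with `α` the `i`-th unit multi-index bounds `|s| |D^γ f|`, which gives
decay like `1 / |s|`. -/
theorem tendsto_multiD_update (hpos : ∀ p, 0 < M p) (f : UltraSpace M d) (γ : Fin d → ℕ)
    (i : Fin d) (x : Fin d → ℝ) :
    Tendsto (fun s => multiD γ f.toFun (WithLp.toLp 2 (Function.update x i s)))
      (cocompact ℝ) (𝓝 0) := by
  have hinv : Tendsto (fun s : ℝ => M (∑ k, ((Pi.single i 1 : Fin d → ℕ) k + γ k)) *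
      seminorm M d 1 f * ‖s‖⁻¹) (cocompact ℝ) (𝓝 0) := by
    simpa using (tendsto_inv_atTop_zero.comp (tendsto_norm_cocompact_atTop (E := ℝ))).const_mul
      (M (∑ k, ((Pi.single i 1 : Fin d → ℕ) k + γ k)) * seminorm M d 1 f)
  refine squeeze_zero_norm' ?_ hinv
  filter_upwards [(tendsto_norm_cocompact_atTop (E := ℝ)).eventually (eventually_gt_atTop (0 : ℝ))] with s hs
  have h := weightedTerm_le_seminorm 1 f
    (Pi.single i 1, γ, WithLp.toLp 2 (Function.update x i s))
  rw [weightedTerm_eq hpos] at h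
  have hprod : ∏ k, (Function.update x i s) k ^ (Pi.single i 1 : Fin d → ℕ) k = s := by
    rw [Finset.prod_eq_single i (fun k _ hk => by simp [Pi.single_eq_of_ne hk]) (by simp)]
    simp
  simp only [hprod, PNat.one_coe, Nat.cast_one, one_pow] at h
  have hMp := hpos (∑ k, ((Pi.single i 1 : Fin d → ℕ) k + γ k))
  rw [← div_eq_mul_inv, le_div_iff₀ hs, mul_comm (‖multiD _ _ _‖)]
  rwa [div_mul_eq_mul_div, one_mul, div_le_iff₀ hMp, mul_comm (seminorm M d 1 f)] at h

/-- The weight of the functional at `(α, β, y)` that is used to dominate the `j`-th seminorm. -/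
noncomputable def functionalWeight (M : ℕ → ℝ) (j : ℕ+) (t : (Fin d → ℕ) × (Fin d → ℕ) × (Fin d → ℝ)) : ℝ :=
  (∏ i, (2 : ℝ) ^ (t.1 i + 1)) * (∏ i, (2 : ℝ) ^ (t.2.1 i + 1)) *
    (((j : ℕ) : ℝ) ^ (∑ i, (t.1 i + t.2.1 i)) / M (∑ i, (t.1 i + t.2.1 i))) *
      ∏ k, (Real.pi * (1 + t.2.2 k ^ 2) * t.2.2 k ^ t.1 k)

/-- A weighted evaluation of `D^{β + 1} f` at `y`, where `t = (α, β, y)`. -/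
noncomputable def weightedFunctional (M : ℕ → ℝ) (j : ℕ+) (t : (Fin d → ℕ) × (Fin d → ℕ) × (Fin d → ℝ)) :
    UltraSpace M d →ₗ[ℂ] ℂ where
  toFun f := functionalWeight M j t • multiD (t.2.1 + 1) f.toFun (WithLp.toLp 2 t.2.2)
  map_add' f g := by
    rw [toFun_add, multiD_add _ f.contDiff g.contDiff, Pi.add_apply, smul_add]
  map_smul' c f := by
    rw [toFun_smul, multiD_smul _ _ f.contDiff, Pi.smul_apply, smul_comm, RingHom.id_apply]

theorem weightedFunctional_apply (j : ℕ+) (t : (Fin d → ℕ) × (Fin d → ℕ) × (Fin d → ℝ))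
    (f : UltraSpace M d) : weightedFunctional M j t f =
      functionalWeight M j t • multiD (t.2.1 + 1) f.toFun (WithLp.toLp 2 t.2.2) := rfl

theorem measurable_weightedFunctional (j : ℕ+) (f : UltraSpace M d) :
    Measurable fun t => weightedFunctional M j t f := by
  -- There are countably many `α` and `β`, so continuity in `y` suffices.
  refine measurable_from_prod_countable_right fun α =>
    measurable_from_prod_countable_right fun β => ?_
  have h1 : Continuous fun y : Fin d → ℝ => multiD (β + 1) f.toFun (WithLp.toLp 2 y) :=
    (contDiff_multiD f.contDiff _).continuous.comp (PiLp.continuous_toLp 2 _)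
  have h2 : Continuous fun y : Fin d → ℝ => functionalWeight M j (α, β, y) := by
    have h3 : Continuous fun y : Fin d → ℝ => ∏ k, (Real.pi * (1 + y k ^ 2) * y k ^ α k) := by
      fun_prop
    simp only [functionalWeight]
    exact continuous_const.fun_mul h3
  exact (h2.smul h1).measurable

/-- The powers of two in `functionalWeight` cancel the masses of the atoms `α` and `β`, leaving the
integral bound for the chosen term. -/
theorem ofReal_weightedTerm_le_lintegral (hpos : ∀ p, 0 < M p) (j : ℕ+) (f : UltraSpace M d)
    (t : (Fin d → ℕ) × (Fin d → ℕ) × EuclideanSpace ℝ (Fin d)) :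
    ENNReal.ofReal (weightedTerm M j f.toFun t) ≤ ∫⁻ t, ‖weightedFunctional M j t f‖ₑ
      ∂(multiIndexMeasure d).prod ((multiIndexMeasure d).prod
        (Measure.pi fun _ : Fin d => cauchyMeasure 0 1)) := by
  obtain ⟨α, β, x⟩ := t
  set c : ℝ := ((j : ℕ) : ℝ) ^ (∑ i, (α i + β i)) / M (∑ i, (α i + β i)) with hc
  have hc0 : 0 ≤ c := div_nonneg (by positivity) (hpos _).le
  have hmeas := (measurable_weightedFunctional j f).enorm
  have h1 := measure_singleton_mul_lintegral_le (multiIndexMeasure d)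
    ((multiIndexMeasure d).prod (Measure.pi fun _ : Fin d => cauchyMeasure 0 1)) hmeas α
  have h2 := measure_singleton_mul_lintegral_le (multiIndexMeasure d)
    (Measure.pi fun _ : Fin d => cauchyMeasure 0 1)
      (hmeas.comp (measurable_prodMk_left (x := α))) β
  refine le_trans ?_ ((mul_le_mul_right h2 _).trans h1)
  have h3 := enorm_monomial_mul_multiD_le f.contDiff (tendsto_multiD_update hpos f) α β x.ofLp
  have hα := multiIndexMeasure_singleton_mul d α
  have hβ := multiIndexMeasure_singleton_mul d β
  calc ENNReal.ofReal (weightedTerm M j f.toFun (α, β, x))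
      = ‖c‖ₑ * (‖∏ k, x k ^ α k‖ₑ * ‖multiD β f.toFun x‖ₑ) := by
        rw [weightedTerm_eq hpos, ENNReal.ofReal_mul hc0, ENNReal.ofReal_mul (abs_nonneg _),
          Real.enorm_of_nonneg hc0, ← ofReal_norm, ← ofReal_norm, Real.norm_eq_abs]
    _ ≤ ‖c‖ₑ * ∫⁻ y, ‖∏ k, (Real.pi * (1 + y k ^ 2) * y k ^ α k)‖ₑ *
          ‖multiD (β + 1) f.toFun (WithLp.toLp 2 y)‖ₑ
            ∂Measure.pi fun _ : Fin d => cauchyMeasure 0 1 := by gcongr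
    _ = (multiIndexMeasure d {α} * ‖∏ i, (2 : ℝ) ^ (α i + 1)‖ₑ) *
          (multiIndexMeasure d {β} * ‖∏ i, (2 : ℝ) ^ (β i + 1)‖ₑ) * (‖c‖ₑ *
          ∫⁻ y, ‖∏ k, (Real.pi * (1 + y k ^ 2) * y k ^ α k)‖ₑ *
            ‖multiD (β + 1) f.toFun (WithLp.toLp 2 y)‖ₑ
              ∂Measure.pi fun _ : Fin d => cauchyMeasure 0 1) := by rw [hα, hβ, one_mul, one_mul]
    _ = multiIndexMeasure d {α} * (multiIndexMeasure d {β} *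
          ((‖∏ i, (2 : ℝ) ^ (α i + 1)‖ₑ * ‖∏ i, (2 : ℝ) ^ (β i + 1)‖ₑ * ‖c‖ₑ) *
          ∫⁻ y, ‖∏ k, (Real.pi * (1 + y k ^ 2) * y k ^ α k)‖ₑ *
            ‖multiD (β + 1) f.toFun (WithLp.toLp 2 y)‖ₑ
              ∂Measure.pi fun _ : Fin d => cauchyMeasure 0 1)) := by ring
    _ = _ := by
        rw [← lintegral_const_mul' _ _ (by finiteness)]
        congr 2
        refine lintegral_congr fun y => ?_
        rw [Function.comp_apply, weightedFunctional_apply, enorm_smul, functionalWeight,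
          enorm_mul _ (∏ k, _), enorm_mul _ (_ / _), enorm_mul (∏ i, _)]
        ring

/-- `1 + y² ≤ 2 max(1, y²)`. Letting the exponent depend on `y` keeps the right side a single
monomial, as the seminorms require. -/
theorem abs_prod_cauchy_weight_le (α : Fin d → ℕ) (y : Fin d → ℝ) :
    |∏ k, (Real.pi * (1 + y k ^ 2) * y k ^ α k)| ≤
      (2 * Real.pi) ^ d * |∏ k, y k ^ (α k + if 1 < |y k| then 2 else 0)| := by
  rw [Finset.abs_prod, Finset.abs_prod]
  have : (2 * Real.pi) ^ d = ∏ _k : Fin d, (2 * Real.pi) := by simp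
  rw [this, ← Finset.prod_mul_distrib]
  refine Finset.prod_le_prod (fun k _ => abs_nonneg _) fun k _ => ?_
  have hπ := Real.pi_pos
  rw [abs_mul, abs_of_pos (by positivity : 0 < Real.pi * (1 + y k ^ 2)), pow_add, abs_mul,
    mul_left_comm, mul_comm]
  refine mul_le_mul_of_nonneg_left ?_ (abs_nonneg (y k ^ α k))
  split_ifs with h
  · have : 1 ≤ y k ^ 2 := by
      rw [← sq_abs]
      exact one_le_pow₀ (le_of_lt h)
    rw [abs_of_nonneg (sq_nonneg (y k))]
    nlinarith
  · have : y k ^ 2 ≤ 1 := by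
      rw [← sq_abs]
      exact pow_le_one₀ (abs_nonneg (y k)) (le_of_not_gt h)
    rw [pow_zero, abs_one, mul_one]
    nlinarith

theorem exists_norm_weightedFunctional_le (hpos : ∀ p, 0 < M p) (hM : CondM2' M) (j : ℕ+) :
    ∃ (k : ℕ+) (C : NNReal), ∀ (t : (Fin d → ℕ) × (Fin d → ℕ) × (Fin d → ℝ))
      (f : UltraSpace M d), ‖weightedFunctional M j t f‖ ≤ C * seminorm M d k f := by
  obtain ⟨B, hB, K, hK, hBK⟩ := hM.exists_shift_le hpos (3 * d)
  obtain ⟨k, hk⟩ : ∃ k : ℕ+, 2 * ((j : ℕ) : ℝ) * K ≤ ((k : ℕ) : ℝ) := by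
    obtain ⟨n, hn⟩ := exists_nat_ge (2 * ((j : ℕ) : ℝ) * K)
    exact ⟨n.succPNat, hn.trans (by simp)⟩
  have hk1 : (1 : ℝ) ≤ ((k : ℕ) : ℝ) := by exact_mod_cast k.2
  refine ⟨k, ⟨4 ^ d * (2 * Real.pi) ^ d * B, by positivity⟩, fun t f => ?_⟩
  obtain ⟨α, β, y⟩ := t
  set α' : Fin d → ℕ := fun i => α i + if 1 < |y i| then 2 else 0 with hα'
  set N := ∑ i, (α i + β i) with hN
  obtain ⟨m, hm, hN'⟩ : ∃ m ≤ 3 * d, ∑ i, (α' i + (β + 1) i) = N + m := by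
    -- Each coordinate contributes one derivative and, when `|y i| > 1`, two powers from the Cauchy
    -- weight.
    refine ⟨∑ i, ((if 1 < |y i| then 2 else 0) + 1), ?_, ?_⟩
    · calc ∑ i, ((if 1 < |y i| then 2 else 0) + 1) ≤ ∑ _i : Fin d, 3 :=
            Finset.sum_le_sum fun i _ => by split_ifs <;> norm_num
        _ = 3 * d := by simp [mul_comm]
    · rw [hN, ← Finset.sum_add_distrib]
      refine Finset.sum_congr rfl fun i _ => ?_
      simp only [hα', Pi.add_apply, Pi.one_apply]
      ring
  have hpow : (∏ i, (2 : ℝ) ^ (α i + 1)) * ∏ i, (2 : ℝ) ^ (β i + 1) = 4 ^ d * 2 ^ N := by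
    rw [← Finset.prod_mul_distrib, hN, ← Finset.prod_pow_eq_pow_sum]
    have : (4 : ℝ) ^ d = ∏ _i : Fin d, (4 : ℝ) := by simp
    rw [this, ← Finset.prod_mul_distrib]
    refine Finset.prod_congr rfl fun i _ => ?_
    ring
  have hterm := weightedTerm_le_seminorm k f (α', β + 1, WithLp.toLp 2 y)
  rw [weightedTerm_eq hpos] at hterm
  simp only [hN'] at hterm
  set D := ‖multiD (β + 1) f.toFun (WithLp.toLp 2 y)‖ with hD
  set P := |∏ i, y i ^ α' i| with hP
  have hMN := hpos N
  have hMm := hpos (N + m)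
  have hPD : P * D ≤ M (N + m) / ((k : ℕ) : ℝ) ^ (N + m) * seminorm M d k f := by
    rw [div_mul_eq_mul_div, le_div_iff₀ (by positivity)]
    rw [div_mul_eq_mul_div, div_le_iff₀ hMm] at hterm
    linarith
  have hq : 0 ≤ seminorm M d k f := apply_nonneg _ _
  -- The geometric weights cost `2 ^ N` and the shift of `M` costs `B * K ^ N`; the choice `k ≥ 2 j
  -- K` pays for all but `B`.
  have hratio : 2 ^ N * (((j : ℕ) : ℝ) ^ N / M N) * (M (N + m) / ((k : ℕ) : ℝ) ^ (N + m)) ≤ B := by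
    have h1 : (2 * ((j : ℕ) : ℝ) * K) ^ N ≤ ((k : ℕ) : ℝ) ^ (N + m) :=
      (pow_le_pow_left₀ (by positivity) hk N).trans
        (pow_le_pow_right₀ hk1 (Nat.le_add_right N m))
    calc 2 ^ N * (((j : ℕ) : ℝ) ^ N / M N) * (M (N + m) / ((k : ℕ) : ℝ) ^ (N + m))
        ≤ 2 ^ N * (((j : ℕ) : ℝ) ^ N / M N) * (B * K ^ N * M N / ((k : ℕ) : ℝ) ^ (N + m)) := by
          gcongr
          exact hBK m hm N
      _ = B * ((2 * ((j : ℕ) : ℝ) * K) ^ N / ((k : ℕ) : ℝ) ^ (N + m)) := by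
          field_simp
          ring
      _ ≤ B * 1 := by
          gcongr
          exact (div_le_one (by positivity)).2 h1
      _ = B := mul_one B
  rw [weightedFunctional_apply, norm_smul, functionalWeight, hpow, Real.norm_eq_abs, abs_mul,
    abs_of_nonneg (by positivity : 0 ≤ 4 ^ d * 2 ^ N * (((j : ℕ) : ℝ) ^ N / M N))]
  calc 4 ^ d * 2 ^ N * (((j : ℕ) : ℝ) ^ N / M N) *
        |∏ i, (Real.pi * (1 + y i ^ 2) * y i ^ α i)| * D
      ≤ 4 ^ d * 2 ^ N * (((j : ℕ) : ℝ) ^ N / M N) * ((2 * Real.pi) ^ d * P) * D := by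
        gcongr
        exact abs_prod_cauchy_weight_le α y
    _ = 4 ^ d * (2 * Real.pi) ^ d * (2 ^ N * (((j : ℕ) : ℝ) ^ N / M N)) * (P * D) := by ring
    _ ≤ 4 ^ d * (2 * Real.pi) ^ d * (2 ^ N * (((j : ℕ) : ℝ) ^ N / M N)) *
          (M (N + m) / ((k : ℕ) : ℝ) ^ (N + m) * seminorm M d k f) := by gcongr
    _ = 4 ^ d * (2 * Real.pi) ^ d * (2 ^ N * (((j : ℕ) : ℝ) ^ N / M N) *
          (M (N + m) / ((k : ℕ) : ℝ) ^ (N + m))) * seminorm M d k f := by ring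
    _ ≤ 4 ^ d * (2 * Real.pi) ^ d * B * seminorm M d k f := by gcongr

theorem exists_absDominated_seminorm (hpos : ∀ p, 0 < M p) (hM : CondM2' M) (j : ℕ+) :
    ∃ (k : ℕ+) (C : NNReal), AbsDominated (seminorm M d j) (C • seminorm M d k) := by
  obtain ⟨k, C, hC⟩ := exists_norm_weightedFunctional_le (d := d) hpos hM j
  refine ⟨k, C, _, inferInstance, (multiIndexMeasure d).prod ((multiIndexMeasure d).prod
    (Measure.pi fun _ : Fin d => cauchyMeasure 0 1)), inferInstance, weightedFunctional M j,
    measurable_weightedFunctional j, hC, fun f => ?_⟩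
  -- Passing from each term to the supremum uses a real upper bound, so an infinite integral is
  -- treated separately.
  rcases eq_or_ne (∫⁻ t, ‖weightedFunctional M j t f‖ₑ ∂(multiIndexMeasure d).prod
    ((multiIndexMeasure d).prod (Measure.pi fun _ : Fin d => cauchyMeasure 0 1))) ⊤ with h | h
  · rw [h]
    exact le_top
  · rw [ENNReal.ofReal_le_iff_le_toReal h, seminorm_apply]
    exact ciSup_le fun t => (ENNReal.ofReal_le_iff_le_toReal h).1
      (ofReal_weightedTerm_le_lintegral hpos j f t)

/-! ### Nuclearity -/

theorem withSeminorms : WithSeminorms (seminorm M d) := ⟨rfl⟩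

end UltraSpace

theorem AbsDominated.of_le_smul {E : Type*} [AddCommGroup E] [Module ℂ E]
    {p p' q : Seminorm ℂ E} (h : AbsDominated p q) (C : NNReal) (hp : p' ≤ C • p) :
    AbsDominated p' (C • q) := by
  obtain ⟨T, _, μ, _, φ, hmeas, hbd, hpφ⟩ := h
  refine ⟨T, _, μ, inferInstance, fun t => (C : ℂ) • φ t, fun f => (hmeas f).const_smul (C : ℂ),
    fun t f => ?_, fun f => ?_⟩
  · rw [LinearMap.smul_apply, norm_smul]
    change _ ≤ (C : ℝ) * q f
    have : ‖(C : ℂ)‖ = C := by simp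
    rw [this]
    exact mul_le_mul_of_nonneg_left (hbd t f) C.2
  · have hC : ‖(C : ℂ)‖ₑ = C := by
      rw [← ofReal_norm]
      simp
    simp only [LinearMap.smul_apply, enorm_smul, hC]
    rw [lintegral_const_mul' _ _ ENNReal.coe_ne_top]
    calc ENNReal.ofReal (p' f) ≤ ENNReal.ofReal (C * p f) := ENNReal.ofReal_le_ofReal (hp f)
      _ = C * ENNReal.ofReal (p f) := by
        rw [ENNReal.ofReal_mul C.coe_nonneg, ENNReal.ofReal_coe_nnreal]
      _ ≤ _ := by
        gcongr
        exact hpφ f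

namespace UltraSpace

variable {M : ℕ → ℝ} {d : ℕ}

theorem exists_absDominated (hpos : ∀ p, 0 < M p) (hM : CondM2' M)
    (p : Seminorm ℂ (UltraSpace M d)) (hp : Continuous p) :
    ∃ q : Seminorm ℂ (UltraSpace M d), Continuous q ∧ AbsDominated p q := by
  obtain ⟨s, C, -, hC⟩ := Seminorm.bound_of_continuous withSeminorms p hp
  -- The defining seminorms increase with `j`, so one of them dominates the finite supremum.
  obtain ⟨j, hj⟩ := s.exists_le
  obtain ⟨k, C', hk⟩ := exists_absDominated_seminorm (d := d) hpos hM j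
  refine ⟨C • (C' • seminorm M d k), ?_, hk.of_le_smul C (hC.trans fun f => ?_)⟩
  · exact ((withSeminorms.continuous_seminorm k).const_smul C').const_smul C
  · exact mul_le_mul_of_nonneg_left
      (Finset.sup_le (fun i hi => seminorm_mono hpos (hj i hi)) f) C.2

theorem multiD_zero (f : EuclideanSpace ℝ (Fin d) → ℂ) : multiD 0 f = f := by
  unfold multiD
  induction List.finRange d with
  | nil => rfl
  | cons i l ih => rw [List.foldr_cons, ih]; rfl

theorem t2Space (hpos : ∀ p, 0 < M p) : T2Space (UltraSpace M d) := by
  have := withSeminorms.topologicalAddGroup (p := seminorm M d)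
  have : T1Space (UltraSpace M d) := withSeminorms.T1_of_separating (p := seminorm M d)
    fun f hf => ⟨1, fun h => hf (Subtype.ext (funext fun x => ?_))⟩
  · infer_instance
  -- The term with `α = β = 0` and `j = 1` is `|f x| / M 0`, so the first seminorm already separates
  -- points.
  · have h1 := weightedTerm_le_seminorm 1 f (0, 0, x)
    rw [h, weightedTerm_eq hpos, multiD_zero] at h1
    have h2 := hpos 0
    simp only [Pi.zero_apply, add_zero, Finset.sum_const_zero, pow_zero, Finset.prod_const_one,
      abs_one, one_mul] at h1
    exact norm_le_zero_iff.1 (nonpos_of_mul_nonpos_right h1 (by positivity))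

end UltraSpace

theorem corollary2p3 (d : ℕ) (M : ℕ → ℝ) (hpos : ∀ p, 0 < M p)
    (hM2 : CondM2' M) (hH : CondHermite M) :
    IsNuclearSpace (UltraSpace M d) := by
  refine ⟨UltraSpace.t2Space hpos, UltraSpace.withSeminorms.toPolynormableSpace,
    fun p₀ hp₀ => ?_⟩
  obtain ⟨p₁, hp₁, h₀₁⟩ := UltraSpace.exists_absDominated hpos hM2 p₀ hp₀
  obtain ⟨p₂, hp₂, h₁₂⟩ := UltraSpace.exists_absDominated hpos hM2 p₁ hp₁
  obtain ⟨p₃, hp₃, h₂₃⟩ := UltraSpace.exists_absDominated hpos hM2 p₂ hp₂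
  obtain ⟨h, hnuc⟩ := h₀₁.isNuclearOperator_linkingMap h₁₂ h₂₃
  exact ⟨p₃, h, hp₃, hnuc⟩
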